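/- All algebras are commutative (not necessarily unital) algebras over a fixed ground ring. A *crossed module* over a unital algebra $P$ is an algebra morphism $\partial:A\to P$ with a (unital) action of $P$ on the algebra $A$ such that $\partial(p\cdot a)=p\,\partial a$ and $\partial a\cdot a'=aa'$; without the last condition it is a *pre-crossed module*. A *crossed square* $(L,M,N,P)$ consists of crossed modules $\mu:M\to P$, $\nu:N\to P$, a $P$-algebra $L$, $P$-equivariant algebra morphisms $\lambda:L\to M$, $\lambda':L\to N$ with $\mu\lambda=\nu\lambda'$ a crossed module, and a $P$-bilinear map $h:M\times N\to L$ with $\lambda h(m,n)=\nu(n)\cdot m$, $\lambda'h(m,n)=\mu(m)\cdot n$, $h(\lambda l,n)=\nu(n)\cdot l$, $h(m,\lambda'l)=\mu(m)\cdot l$. Let $\partial:M\to R$ be a pre-crossed module over a unital algebra $R$ (for instance the free one on a function $f_2:S_2\to R$). Regard $M=\{(m,0)\}$ and $\overline M=\{(m,r):\partial m=-r\}$ as ideals of $M\rtimes R$, hence as crossed modules over $M\rtimes R$. Let $f_3:S_3\to M$ be a function on a set with $\partial f_3=0$. A crossed square $(L,M,\overline M,M\rtimes R)$ with a function $\nu:S_3\to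 L$ is *free* on this data if the composites of $\nu$ with $L\to M$ and $L\to\overline M$ are $y\mapsto f_3y$ and $y\mapsto(f_3y,0)$, and for every crossed square $(L',M,\overline M,M\rtimes R)$ and every $\nu':S_3\to L'$ whose composite with $L'\to M$ is $f_3$ there is a unique morphism of crossed squares $(\phi,\mathrm{id},\mathrm{id},\mathrm{id})$ with $\phi\nu=\nu'$. (It is *totally free* on $(f_2,f_3)$ if moreover $M\to R$ is the free pre-crossed module on $f_2$.) For crossed modules $A,B$ over $P$ let $A\otimes B$ be the algebra generated by symbols $a\otimes b$, bilinear over $P$, with $(a\otimes b)(a'\otimes b')=aa'\otimes bb'$; it is a crossed module over $P$ with boundary $a\otimes b\mapsto\partial a\,\partial b$. Let $A\sqcup B$ be the coproduct of crossed modules over $P$, i.e. the quotient of $A\rtimes B$, with product $(a,b)(a',b')=(aa',\,\partial a'\cdot b+\partial a\cdot b'+bb')$ and boundary $\delta(a,b)=\partial a+\partial b$, by the ideal generated by all $xy-\delta(x)\cdot y$; let $i:A\to A\sqcup B$ and $j:B\to A\sqcup B$ be the canonical maps. **Proposition 5.1.** Let $(L,M,\overline M,M\rtimes R)$ with $\nu:S_3\to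 L$ be a free crossed square on the above data, and let $\partial:C\to M\rtimes R$, with $\iota:S_3\to C$, be the free crossed module on the function $y\mapsto(f_3y,0)$. Then there is an isomorphism of $(M\rtimes R)$-algebras $$L\;\cong\;\{(M\otimes\overline M)\sqcup C\}/\!\sim ,$$ where $\sim$ is given by the relations $$i(\partial c\otimes\overline n)\sim j(\overline n\cdot c),\qquad i(m\otimes\partial c)\sim j(m\cdot c)\qquad(c\in C,\ m\in M,\ \overline n\in\overline M),$$ $\partial c$ being regarded as an element of $M$ and of $\overline M$ respectively. Under this isomorphism, $L\to M$ and $L\to\overline M$ are given on $M\otimes\overline M$ by $m\otimes\overline n\mapsto\overline n\cdot m$ and $m\otimes\overline n\mapsto m\cdot\overline n$, and on $C$ by $\partial:C\to M\cap\overline M$; the $h$-map is $h(m,\overline n)=i(m\otimes\overline n)$; and $\nu(y)$ corresponds to $j(\iota(y))$. -/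

import Mathlib

open scoped TensorProduct

universe u

noncomputable section

/-! All algebras are commutative.  The algebra `P` that acts is unital and its actions are unital,
so the ground ring acts on everything through `P`, and every `P`-equivariant map is linear over the
ground ring; the ground ring is therefore not displayed.  The algebras acted upon need not have a
unit. -/

/-- A pre-crossed module of commutative algebras over `P`: a commutative (non-unital) algebra
`carrier`, on which `P` acts compatibly with the multiplication, and a morphism of algebras
`bd : carrier → P` (the boundary map) that respects the actions of `P`. -/
structure PreCrossedModule (P : Type u) [CommRing P] where
  carrier : Type u
  [ring : NonUnitalCommRing carrier]
  [module : Module P carrier]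
  [tower : IsScalarTower P carrier carrier]
  /-- The boundary map.  Linearity over `P` says that `bd (p • a) = p * bd a`. -/
  bd : carrier →ₗ[P] P
  bd_mul : ∀ a b : carrier, bd (a * b) = bd a * bd b

namespace PreCrossedModule

attribute [instance] PreCrossedModule.ring PreCrossedModule.module PreCrossedModule.tower

variable {P : Type u} [CommRing P]

instance smulCommClass (A : PreCrossedModule P) : SMulCommClass P A.carrier A.carrier where
  smul_comm p a b := by
    simp only [smul_eq_mul]
    rw [mul_comm a (p • b), smul_mul_assoc, mul_comm b a]

end PreCrossedModule

/-- A crossed module: a pre-crossed module with `bd a • b = a * b`. -/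
structure CrossedModule (P : Type u) [CommRing P] extends PreCrossedModule P where
  peiffer : ∀ a b : carrier, bd a • b = a * b

/-- A morphism of crossed modules over `P` (the identity on `P`). -/
structure CrossedModule.Hom {P : Type u} [CommRing P] (A B : CrossedModule P) where
  toFun : A.carrier →ₗ[P] B.carrier
  map_mul : ∀ a b, toFun (a * b) = toFun a * toFun b
  bd_comp : ∀ a, B.bd (toFun a) = A.bd a

/-- `C`, with `ι : S → C`, is the free crossed module on the function `g : S → P`. -/
structure CrossedModule.IsFree {P : Type u} [CommRing P] (C : CrossedModule P) {S : Type u}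
    (g : S → P) (ι : S → C.carrier) : Prop where
  bd_ι : ∀ y, C.bd (ι y) = g y
  existsUnique : ∀ (D : CrossedModule P) (κ : S → D.carrier), (∀ y, D.bd (κ y) = g y) →
    ∃! φ : CrossedModule.Hom C D, ∀ y, φ.toFun (ι y) = κ y

/-! ### Quotients -/

namespace PreCrossedModule

variable {P : Type u} [CommRing P]

/-- The (`P`-invariant) ideal of `A` generated by the set `s`. -/
def idealSpan (A : PreCrossedModule P) (s : Set A.carrier) : Submodule P A.carrier :=
  sInf {I | s ⊆ I ∧ ∀ a, ∀ x ∈ I, a * x ∈ I}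

theorem subset_idealSpan (A : PreCrossedModule P) (s : Set A.carrier) :
    s ⊆ A.idealSpan s := by
  intro x hx
  simp only [idealSpan, SetLike.mem_coe, Submodule.mem_sInf]
  exact fun I hI => hI.1 hx

theorem mul_mem_idealSpan (A : PreCrossedModule P) (s : Set A.carrier) (a : A.carrier)
    {x : A.carrier} (hx : x ∈ A.idealSpan s) : a * x ∈ A.idealSpan s := by
  simp only [idealSpan, Submodule.mem_sInf] at hx ⊢
  exact fun I hI => hI.2 a x (hx I hI)

theorem idealSpan_le (A : PreCrossedModule P) (s : Set A.carrier) (I : Submodule P A.carrier)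
    (h₁ : s ⊆ I) (h₂ : ∀ a, ∀ x ∈ I, a * x ∈ I) : A.idealSpan s ≤ I :=
  sInf_le ⟨h₁, h₂⟩

/-- The quotient of `A` by the ideal generated by the set `s`, as a type. -/
def Quot (A : PreCrossedModule P) (s : Set A.carrier) : Type u := A.carrier ⧸ A.idealSpan s

namespace Quot

variable (A : PreCrossedModule P) (s : Set A.carrier)

instance : AddCommGroup (A.Quot s) := inferInstanceAs (AddCommGroup (A.carrier ⧸ A.idealSpan s))

instance : Module P (A.Quot s) := inferInstanceAs (Module P (A.carrier ⧸ A.idealSpan s))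

/-- The projection onto the quotient. -/
def mk : A.carrier →ₗ[P] A.Quot s := (A.idealSpan s).mkQ

theorem mk_surjective : Function.Surjective (mk A s) := (A.idealSpan s).mkQ_surjective

/-- The multiplication of the quotient: the class of `a` times the class of `b` is the class of
`a * b`. -/
instance : Mul (A.Quot s) where
  mul := Quotient.map₂ (· * ·) (by
    intro a a' ha b b' hb
    have ha' : a - a' ∈ A.idealSpan s := (Submodule.quotientRel_def _).1 ha
    have hb' : b - b' ∈ A.idealSpan s := (Submodule.quotientRel_def _).1 hb
    refine (Submodule.quotientRel_def _).2 ?_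
    have : a * b - a' * b' = b * (a - a') + a' * (b - b') := by
      rw [mul_sub, mul_sub, mul_comm b a, mul_comm b a']
      abel
    rw [this]
    exact add_mem (A.mul_mem_idealSpan s _ ha') (A.mul_mem_idealSpan s _ hb'))

theorem mk_mul (a b : A.carrier) : mk A s (a * b) = mk A s a * mk A s b := rfl

instance : NonUnitalCommRing (A.Quot s) where
  __ := (inferInstance : AddCommGroup (A.Quot s))
  left_distrib x y z := by
    obtain ⟨a, rfl⟩ := mk_surjective A s x
    obtain ⟨b, rfl⟩ := mk_surjective A s y
    obtain ⟨c, rfl⟩ := mk_surjective A s z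
    rw [← map_add, ← mk_mul, ← mk_mul, ← mk_mul, ← map_add, mul_add]
  right_distrib x y z := by
    obtain ⟨a, rfl⟩ := mk_surjective A s x
    obtain ⟨b, rfl⟩ := mk_surjective A s y
    obtain ⟨c, rfl⟩ := mk_surjective A s z
    rw [← map_add, ← mk_mul, ← mk_mul, ← mk_mul, ← map_add, add_mul]
  zero_mul x := by
    obtain ⟨a, rfl⟩ := mk_surjective A s x
    rw [← map_zero (mk A s), ← mk_mul, zero_mul]
  mul_zero x := by
    obtain ⟨a, rfl⟩ := mk_surjective A s x
    rw [← map_zero (mk A s), ← mk_mul, mul_zero]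
  mul_assoc x y z := by
    obtain ⟨a, rfl⟩ := mk_surjective A s x
    obtain ⟨b, rfl⟩ := mk_surjective A s y
    obtain ⟨c, rfl⟩ := mk_surjective A s z
    rw [← mk_mul, ← mk_mul, ← mk_mul, ← mk_mul, mul_assoc]
  mul_comm x y := by
    obtain ⟨a, rfl⟩ := mk_surjective A s x
    obtain ⟨b, rfl⟩ := mk_surjective A s y
    rw [← mk_mul, ← mk_mul, mul_comm]

instance tower : IsScalarTower P (A.Quot s) (A.Quot s) where
  smul_assoc p x y := by
    obtain ⟨a, rfl⟩ := mk_surjective A s x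
    obtain ⟨b, rfl⟩ := mk_surjective A s y
    simp only [smul_eq_mul]
    rw [← map_smul, ← mk_mul, ← mk_mul, ← map_smul, smul_mul_assoc]

end Quot

theorem idealSpan_le_ker (A : PreCrossedModule P) (s : Set A.carrier)
    (hs : ∀ x ∈ s, A.bd x = 0) : A.idealSpan s ≤ LinearMap.ker A.bd := by
  refine A.idealSpan_le s _ (fun x hx => hs x hx) fun a x hx => ?_
  rw [LinearMap.mem_ker] at hx ⊢
  rw [A.bd_mul, hx, mul_zero]

/-- The quotient of the pre-crossed module `A` by the ideal generated by a set `s` of elements with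
zero boundary. -/
def quotient (A : PreCrossedModule P) (s : Set A.carrier) (hs : ∀ x ∈ s, A.bd x = 0) :
    PreCrossedModule P where
  carrier := A.Quot s
  tower := Quot.tower A s
  bd := (A.idealSpan s).liftQ A.bd (A.idealSpan_le_ker s hs)
  bd_mul x y := by
    obtain ⟨a, rfl⟩ := Quot.mk_surjective A s x
    obtain ⟨b, rfl⟩ := Quot.mk_surjective A s y
    exact A.bd_mul a b

end PreCrossedModule

namespace CrossedModule

variable {P : Type u} [CommRing P]

/-- The quotient of the crossed module `A` by the ideal generated by a set `s` of elements with
zero boundary. -/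
def quotient (A : CrossedModule P) (s : Set A.carrier) (hs : ∀ x ∈ s, A.bd x = 0) :
    CrossedModule P where
  __ := A.toPreCrossedModule.quotient s hs
  peiffer x y := by
    obtain ⟨a, rfl⟩ := PreCrossedModule.Quot.mk_surjective A.toPreCrossedModule s x
    obtain ⟨b, rfl⟩ := PreCrossedModule.Quot.mk_surjective A.toPreCrossedModule s y
    exact congrArg (PreCrossedModule.Quot.mk A.toPreCrossedModule s) (A.peiffer a b)

/-- The projection onto the quotient. -/
def quotientMk (A : CrossedModule P) (s : Set A.carrier) (hs : ∀ x ∈ s, A.bd x = 0) :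
    A.carrier →ₗ[P] (A.quotient s hs).carrier :=
  PreCrossedModule.Quot.mk A.toPreCrossedModule s

/-! ### The tensor product of two crossed modules -/

/-- The map `A ⊗ B → A`, `a ⊗ b ↦ bd b • a`. -/
def tensorFst (A B : CrossedModule P) : A.carrier ⊗[P] B.carrier →ₗ[P] A.carrier :=
  TensorProduct.lift ((LinearMap.lsmul P A.carrier).flip.compl₂ B.bd)

/-- The map `A ⊗ B → B`, `a ⊗ b ↦ bd a • b`. -/
def tensorSnd (A B : CrossedModule P) : A.carrier ⊗[P] B.carrier →ₗ[P] B.carrier :=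
  TensorProduct.lift ((LinearMap.lsmul P B.carrier).comp A.bd)

@[simp] theorem tensorFst_tmul (A B : CrossedModule P) (a : A.carrier) (b : B.carrier) :
    tensorFst A B (a ⊗ₜ b) = B.bd b • a := rfl

@[simp] theorem tensorSnd_tmul (A B : CrossedModule P) (a : A.carrier) (b : B.carrier) :
    tensorSnd A B (a ⊗ₜ b) = A.bd a • b := rfl

/-- The multiplication of `A ⊗ B`: `(a ⊗ b) (a' ⊗ b') = a a' ⊗ b b'`. -/
instance tensorRing (A B : CrossedModule P) :
    NonUnitalCommRing (A.carrier ⊗[P] B.carrier) where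
  __ := (inferInstance : NonUnitalRing (A.carrier ⊗[P] B.carrier))
  mul_comm x y := by
    induction x using TensorProduct.induction_on with
    | zero => rw [zero_mul, mul_zero]
    | add x x' hx hx' => rw [add_mul, mul_add, hx, hx']
    | tmul a b =>
      induction y using TensorProduct.induction_on with
      | zero => rw [zero_mul, mul_zero]
      | add y y' hy hy' => rw [add_mul, mul_add, hy, hy']
      | tmul a' b' =>
        rw [Algebra.TensorProduct.tmul_mul_tmul, Algebra.TensorProduct.tmul_mul_tmul,
          mul_comm a, mul_comm b]

/-- The tensor product `A ⊗ B` of two crossed modules over `P`, as a crossed module over `P`: the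
algebra generated by the symbols `a ⊗ b` subject to bilinearity over `P` and
`(a ⊗ b) (a' ⊗ b') = a a' ⊗ b b'`, with boundary `a ⊗ b ↦ bd a * bd b`. -/
def tensor (A B : CrossedModule P) : CrossedModule P where
  carrier := A.carrier ⊗[P] B.carrier
  ring := tensorRing A B
  tower := ⟨fun p x y => by
    simp only [smul_eq_mul]
    induction x using TensorProduct.induction_on with
    | zero => simp only [zero_mul, smul_zero]
    | add x x' hx hx' => rw [add_mul, smul_add, smul_add, add_mul, hx, hx']
    | tmul a b =>
      induction y using TensorProduct.induction_on with
      | zero => simp only [mul_zero, smul_zero]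
      | add y y' hy hy' => rw [mul_add, mul_add, smul_add, hy, hy']
      | tmul a' b' =>
        rw [TensorProduct.smul_tmul', Algebra.TensorProduct.tmul_mul_tmul,
          Algebra.TensorProduct.tmul_mul_tmul, TensorProduct.smul_tmul', smul_mul_assoc]⟩
  bd := A.bd ∘ₗ tensorFst A B
  bd_mul x y := by
    induction x using TensorProduct.induction_on with
    | zero => simp only [zero_mul, map_zero]
    | add x x' hx hx' => rw [add_mul, map_add, map_add, hx, hx', add_mul]
    | tmul a b =>
      induction y using TensorProduct.induction_on with
      | zero => simp only [mul_zero, map_zero]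
      | add y y' hy hy' => rw [mul_add, map_add, map_add, hy, hy', mul_add]
      | tmul a' b' =>
        rw [Algebra.TensorProduct.tmul_mul_tmul]
        simp only [LinearMap.comp_apply, tensorFst_tmul, map_smul, smul_eq_mul, A.bd_mul, B.bd_mul]
        ring
  peiffer x y := by
    induction x using TensorProduct.induction_on with
    | zero => simp only [zero_mul, map_zero, zero_smul]
    | add x x' hx hx' => rw [add_mul, map_add, add_smul, hx, hx']
    | tmul a b =>
      induction y using TensorProduct.induction_on with
      | zero => simp only [mul_zero, smul_zero]
      | add y y' hy hy' => rw [mul_add, smul_add, hy, hy']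
      | tmul a' b' =>
        rw [Algebra.TensorProduct.tmul_mul_tmul]
        simp only [LinearMap.comp_apply, tensorFst_tmul, map_smul, smul_eq_mul]
        rw [mul_comm, mul_smul, TensorProduct.smul_tmul', ← A.peiffer a a', ← B.peiffer b b',
          ← TensorProduct.smul_tmul, ← TensorProduct.smul_tmul', ← TensorProduct.smul_tmul',
          ← TensorProduct.smul_tmul', smul_comm]

/-- The symbol `a ⊗ b` in `A ⊗ B`. -/
def tmul (A B : CrossedModule P) (a : A.carrier) (b : B.carrier) : (tensor A B).carrier :=
  a ⊗ₜ[P] b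

/-! ### The coproduct of two crossed modules -/

/-- The underlying module of the semidirect product `A ⋊ B`. -/
def Semidirect (A B : CrossedModule P) : Type u := A.carrier × B.carrier

namespace Semidirect

variable (A B : CrossedModule P)

instance : AddCommGroup (Semidirect A B) := inferInstanceAs (AddCommGroup (A.carrier × B.carrier))

instance : Module P (Semidirect A B) := inferInstanceAs (Module P (A.carrier × B.carrier))

instance : Mul (Semidirect A B) where
  mul x y := (x.1 * y.1, A.bd y.1 • x.2 + A.bd x.1 • y.2 + x.2 * y.2)

variable {A B}

@[ext] theorem ext {x y : Semidirect A B} (h₁ : x.1 = y.1) (h₂ : x.2 = y.2) : x = y :=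
  Prod.ext h₁ h₂

theorem fst_mul (x y : Semidirect A B) : (x * y).1 = x.1 * y.1 := rfl

theorem snd_mul (x y : Semidirect A B) :
    (x * y).2 = A.bd y.1 • x.2 + A.bd x.1 • y.2 + x.2 * y.2 := rfl

theorem fst_add (x y : Semidirect A B) : (x + y).1 = x.1 + y.1 := rfl

theorem snd_add (x y : Semidirect A B) : (x + y).2 = x.2 + y.2 := rfl

theorem fst_zero : (0 : Semidirect A B).1 = 0 := rfl

theorem snd_zero : (0 : Semidirect A B).2 = 0 := rfl

theorem fst_smul (p : P) (x : Semidirect A B) : (p • x).1 = p • x.1 := rfl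

theorem snd_smul (p : P) (x : Semidirect A B) : (p • x).2 = p • x.2 := rfl

protected theorem mul_comm' (x y : Semidirect A B) : x * y = y * x := by
  ext
  · rw [fst_mul, fst_mul, mul_comm]
  · rw [snd_mul, snd_mul, mul_comm x.2]
    abel

protected theorem mul_add' (x y z : Semidirect A B) : x * (y + z) = x * y + x * z := by
  ext
  · simp only [fst_mul, fst_add, mul_add]
  · simp only [snd_mul, snd_add, fst_add, map_add, add_smul, smul_add, mul_add]
    abel

protected theorem zero_mul' (x : Semidirect A B) : 0 * x = 0 := by
  ext
  · simp only [fst_mul, fst_zero, zero_mul]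
  · simp only [snd_mul, snd_zero, fst_zero, map_zero, zero_smul, smul_zero, zero_mul, add_zero]

instance : NonUnitalCommRing (Semidirect A B) where
  __ := (inferInstance : AddCommGroup (Semidirect A B))
  mul_comm := Semidirect.mul_comm'
  left_distrib := Semidirect.mul_add'
  right_distrib x y z := by
    rw [Semidirect.mul_comm', Semidirect.mul_add', Semidirect.mul_comm' z,
      Semidirect.mul_comm' z]
  zero_mul := Semidirect.zero_mul'
  mul_zero x := by rw [Semidirect.mul_comm', Semidirect.zero_mul']
  mul_assoc x y z := by
    ext
    · simp only [fst_mul, mul_assoc]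
    · simp only [fst_mul, snd_mul, A.bd_mul, smul_add, add_mul, mul_add, mul_smul, smul_mul_assoc,
        mul_smul_comm, mul_assoc]
      rw [smul_comm (A.bd z.1) (A.bd y.1), smul_comm (A.bd z.1) (A.bd x.1)]
      abel

instance tower : IsScalarTower P (Semidirect A B) (Semidirect A B) where
  smul_assoc p x y := by
    ext
    · simp only [smul_eq_mul, fst_mul, fst_smul, smul_mul_assoc]
    · simp only [smul_eq_mul, snd_mul, fst_smul, snd_smul, smul_add, map_smul,
        smul_mul_assoc, mul_smul]
      rw [smul_comm p (A.bd y.1)]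

end Semidirect

/-- The pre-crossed module `A ⋊ B` over `P`, with
`(a, b) (a', b') = (a a', bd a' • b + bd a • b' + b b')` and boundary `(a, b) ↦ bd a + bd b`. -/
def semidirect (A B : CrossedModule P) : PreCrossedModule P where
  carrier := Semidirect A B
  tower := Semidirect.tower
  bd := A.bd ∘ₗ LinearMap.fst P A.carrier B.carrier + B.bd ∘ₗ LinearMap.snd P A.carrier B.carrier
  bd_mul x y := by
    change A.bd (x.1 * y.1) + B.bd (A.bd y.1 • x.2 + A.bd x.1 • y.2 + x.2 * y.2) =
      (A.bd x.1 + B.bd x.2) * (A.bd y.1 + B.bd y.2)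
    simp only [A.bd_mul, B.bd_mul, map_add, map_smul, smul_eq_mul]
    ring

/-- The Peiffer elements `x y - bd x • y` of `A ⋊ B`. -/
def peifferElements (A B : CrossedModule P) : Set (semidirect A B).carrier :=
  {z | ∃ x y : (semidirect A B).carrier, z = x * y - (semidirect A B).bd x • y}

/-- The coproduct `A ⊔ B` of two crossed modules over `P`: the quotient of `A ⋊ B` by the ideal
generated by the Peiffer elements. -/
def coprod (A B : CrossedModule P) : CrossedModule P where
  __ := (semidirect A B).quotient (peifferElements A B) (by
    rintro _ ⟨x, y, rfl⟩
    rw [map_sub, map_smul, (semidirect A B).bd_mul, smul_eq_mul, sub_self])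
  peiffer x y := by
    obtain ⟨a, rfl⟩ := PreCrossedModule.Quot.mk_surjective (semidirect A B) _ x
    obtain ⟨b, rfl⟩ := PreCrossedModule.Quot.mk_surjective (semidirect A B) _ y
    symm
    exact (Submodule.Quotient.eq _).2
      ((semidirect A B).subset_idealSpan (peifferElements A B) ⟨a, b, rfl⟩)

/-- The canonical map `i : A → A ⊔ B`, the class of `(a, 0)`. -/
def coprodInl (A B : CrossedModule P) : A.carrier →ₗ[P] (coprod A B).carrier :=
  PreCrossedModule.Quot.mk (semidirect A B) (peifferElements A B) ∘ₗ
    LinearMap.inl P A.carrier B.carrier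

/-- The canonical map `j : B → A ⊔ B`, the class of `(0, b)`. -/
def coprodInr (A B : CrossedModule P) : B.carrier →ₗ[P] (coprod A B).carrier :=
  PreCrossedModule.Quot.mk (semidirect A B) (peifferElements A B) ∘ₗ
    LinearMap.inr P A.carrier B.carrier

theorem bd_coprodInl (A B : CrossedModule P) (a : A.carrier) :
    (coprod A B).bd (coprodInl A B a) = A.bd a := by
  change A.bd a + B.bd 0 = A.bd a
  rw [map_zero, add_zero]

theorem bd_coprodInr (A B : CrossedModule P) (b : B.carrier) :
    (coprod A B).bd (coprodInr A B b) = B.bd b := by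
  change A.bd 0 + B.bd b = B.bd b
  rw [map_zero, zero_add]

/-- An ideal of `P` is a crossed module over `P`, with the inclusion as boundary map and with
action by multiplication. -/
def ofIdeal (I : Ideal P) : CrossedModule P where
  carrier := I
  ring :=
    { (inferInstance : AddCommGroup I) with
      mul := fun x y => ⟨x * y, I.mul_mem_left _ y.2⟩
      left_distrib := fun x y z => Subtype.ext (mul_add (x : P) y z)
      right_distrib := fun x y z => Subtype.ext (add_mul (x : P) y z)
      zero_mul := fun x => Subtype.ext (zero_mul (x : P))
      mul_zero := fun x => Subtype.ext (mul_zero (x : P))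
      mul_assoc := fun x y z => Subtype.ext (mul_assoc (x : P) y z)
      mul_comm := fun x y => Subtype.ext (mul_comm (x : P) y) }
  tower := ⟨fun p x y => Subtype.ext (mul_assoc p (x : P) y)⟩
  bd := I.subtype
  bd_mul _ _ := rfl
  peiffer _ _ := rfl

end CrossedModule

/-! ### Crossed squares -/

/-- A crossed square
```
  L  --lam'-->  N
  |lam          |
  v             v
  M  ------->   P
```
of commutative algebras on the corner `M → P ← N` formed by two crossed modules over `P`. -/
structure CrossedSquare {P : Type u} [CommRing P] (M N : CrossedModule P) where
  L : Type u
  [ring : NonUnitalCommRing L]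
  [module : Module P L]
  [tower : IsScalarTower P L L]
  lam : L →ₗ[P] M.carrier
  lam' : L →ₗ[P] N.carrier
  lam_mul : ∀ x y, lam (x * y) = lam x * lam y
  lam'_mul : ∀ x y, lam' (x * y) = lam' x * lam' y
  comm : ∀ x, M.bd (lam x) = N.bd (lam' x)
  /-- The diagonal `L → P` is a crossed module. -/
  peiffer : ∀ x y, M.bd (lam x) • y = x * y
  /-- The `h`-map, bilinear over `P`. -/
  h : M.carrier →ₗ[P] N.carrier →ₗ[P] L
  lam_h : ∀ m n, lam (h m n) = N.bd n • m
  lam'_h : ∀ m n, lam' (h m n) = M.bd m • n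
  h_lam : ∀ x n, h (lam x) n = N.bd n • x
  h_lam' : ∀ m x, h m (lam' x) = M.bd m • x

namespace CrossedSquare

attribute [instance] CrossedSquare.ring CrossedSquare.module CrossedSquare.tower

/-- A morphism of crossed squares on the same corner that is the identity on the corner. -/
structure Hom {P : Type u} [CommRing P] {M N : CrossedModule P} (X Y : CrossedSquare M N) where
  toFun : X.L →ₗ[P] Y.L
  map_mul : ∀ x y, toFun (x * y) = toFun x * toFun y
  lam_comp : ∀ x, Y.lam (toFun x) = X.lam x
  lam'_comp : ∀ x, Y.lam' (toFun x) = X.lam' x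
  map_h : ∀ m n, toFun (X.h m n) = Y.h m n

end CrossedSquare

/-! ### The corner attached to a pre-crossed module, and free crossed squares -/

namespace PreCrossedModule

variable {R : Type u} [CommRing R] (M : PreCrossedModule R)

/-- The semidirect product `M ⋊ R`: pairs `(m, r)` with
`(m, r) (m', r') = (r • m' + r' • m + m m', r r')`.  In Mathlib's unitization the component in `R`
is `fst` and the component in `M` is `snd`; `Unitization.inr m` is `(m, 0)`. -/
abbrev SemiR : Type u := Unitization R M.carrier

/-- `M ⋊ R` acts on `M` as on the ideal of all `(m, 0)`, by multiplication. -/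
instance semiRModule : Module M.SemiR M.carrier where
  smul x m := x.fst • m + x.snd * m
  one_smul m := by
    change (1 : M.SemiR).fst • m + (1 : M.SemiR).snd * m = m
    rw [Unitization.fst_one, Unitization.snd_one, one_smul, zero_mul, add_zero]
  mul_smul x y m := by
    change (x * y).fst • m + (x * y).snd * m =
      x.fst • (y.fst • m + y.snd * m) + x.snd * (y.fst • m + y.snd * m)
    simp only [Unitization.fst_mul, Unitization.snd_mul, mul_smul, smul_add, add_mul, mul_add,
      smul_mul_assoc, mul_smul_comm, mul_assoc]
    abel
  smul_zero x := by
    change x.fst • (0 : M.carrier) + x.snd * 0 = 0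
    rw [smul_zero, mul_zero, add_zero]
  zero_smul m := by
    change (0 : M.SemiR).fst • m + (0 : M.SemiR).snd * m = 0
    rw [Unitization.fst_zero, Unitization.snd_zero, zero_smul, zero_mul, add_zero]
  smul_add x m m' := by
    change x.fst • (m + m') + x.snd * (m + m') =
      (x.fst • m + x.snd * m) + (x.fst • m' + x.snd * m')
    rw [smul_add, mul_add]
    abel
  add_smul x y m := by
    change (x + y).fst • m + (x + y).snd * m = (x.fst • m + x.snd * m) + (y.fst • m + y.snd * m)
    rw [Unitization.fst_add, Unitization.snd_add, add_smul, add_mul]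
    abel

theorem semiR_smul_def (x : M.SemiR) (m : M.carrier) : x • m = x.fst • m + x.snd * m := rfl

/-- The crossed module `μ : M → M ⋊ R`, `m ↦ (m, 0)`. -/
def incl : CrossedModule M.SemiR where
  carrier := M.carrier
  tower := ⟨fun x m m' => by
    simp only [smul_eq_mul, semiR_smul_def, add_mul, smul_mul_assoc, mul_assoc]⟩
  bd :=
    { toFun := fun m => (Unitization.inr m : M.SemiR)
      map_add' := fun m m' => Unitization.inr_add R m m'
      map_smul' := fun x m => by
        ext
        · simp
        · simp [semiR_smul_def] }
  bd_mul m m' := Unitization.inr_mul R m m'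
  peiffer m m' := by
    change (Unitization.inr m : M.SemiR) • m' = m * m'
    rw [semiR_smul_def, Unitization.fst_inr, Unitization.snd_inr, zero_smul, zero_add]

/-- The ideal of all `(m, r)` in `M ⋊ R` with `bd m = - r`. -/
def barIdeal : Ideal M.SemiR where
  carrier := {x | M.bd x.snd = - x.fst}
  add_mem' {x y} hx hy := by
    simp only [Set.mem_ofPred_eq] at hx hy ⊢
    rw [Unitization.snd_add, Unitization.fst_add, map_add, hx, hy, neg_add]
  zero_mem' := by
    simp only [Set.mem_ofPred_eq, Unitization.snd_zero, Unitization.fst_zero, map_zero, neg_zero]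
  smul_mem' x y hy := by
    simp only [Set.mem_ofPred_eq, smul_eq_mul] at hy ⊢
    simp only [Unitization.snd_mul, Unitization.fst_mul, map_add, map_smul, M.bd_mul, hy,
      smul_eq_mul]
    ring

/-- The crossed module `M̄ → M ⋊ R` given by the inclusion of the ideal `M̄` of all `(m, r)` with
`bd m = - r`. -/
def bar : CrossedModule M.SemiR := CrossedModule.ofIdeal M.barIdeal

end PreCrossedModule

/-- The crossed square `(L, M, M̄, M ⋊ R)`, with the function `ν : S → L`, is free on the function
`f : S → M` (where `bd ∘ f = 0`): the functions `y ↦ f y` and `y ↦ (f y, 0)` are the composites of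
`ν` with `L → M` and with `L → M̄`, and `ν` is universal among such functions.  The square is called
totally free if, moreover, `M → R` is a free pre-crossed module. -/
structure CrossedSquare.IsFree {R : Type u} [CommRing R] {M : PreCrossedModule R}
    (X : CrossedSquare M.incl M.bar) {S : Type u} (f : S → M.carrier) (ν : S → X.L) : Prop where
  lam_ν : ∀ y, X.lam (ν y) = f y
  lam'_ν : ∀ y, M.bar.bd (X.lam' (ν y)) = Unitization.inr (f y)
  existsUnique : ∀ (Y : CrossedSquare M.incl M.bar) (κ : S → Y.L), (∀ y, Y.lam (κ y) = f y) →
    ∃! φ : CrossedSquare.Hom X Y, ∀ y, φ.toFun (ν y) = κ y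

/-! ### The quotient `((M ⊗ N) ⊔ C) / ∼` -/

namespace CrossedModule

variable {P : Type u} [CommRing P] (M N C : CrossedModule P)

/-- The relators of `∼` in `(M ⊗ N) ⊔ C`, for crossed modules `M`, `N`, `C` over `P` such that `M`
and `N` are ideals of `P`: they are `i (∂c ⊗ n) - j (n • c)` and `i (m ⊗ ∂c) - j (m • c)`, where
`∂c` in the first (second) relator is the element of `M` (of `N`) that the inclusion sends to
`C.bd c`. -/
def relators : Set (coprod (tensor M N) C).carrier :=
  {z | ∃ (c : C.carrier) (m : M.carrier) (n : N.carrier), M.bd m = C.bd c ∧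
      z = coprodInl (tensor M N) C (tmul M N m n) - coprodInr (tensor M N) C (N.bd n • c)} ∪
  {z | ∃ (c : C.carrier) (m : M.carrier) (n : N.carrier), N.bd n = C.bd c ∧
      z = coprodInl (tensor M N) C (tmul M N m n) - coprodInr (tensor M N) C (M.bd m • c)}

theorem bd_relators : ∀ z ∈ relators M N C, (coprod (tensor M N) C).bd z = 0 := by
  have key : ∀ (m : M.carrier) (n : N.carrier),
      (tensor M N).bd (tmul M N m n) = N.bd n * M.bd m := fun m n => by
    change M.bd (N.bd n • m) = _
    rw [map_smul, smul_eq_mul]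
  rintro z (⟨c, m, n, h, rfl⟩ | ⟨c, m, n, h, rfl⟩)
  · rw [map_sub, bd_coprodInl, bd_coprodInr, key, map_smul, h, smul_eq_mul, sub_self]
  · rw [map_sub, bd_coprodInl, bd_coprodInr, key, map_smul, h, smul_eq_mul, mul_comm, sub_self]

/-- The crossed module `((M ⊗ N) ⊔ C) / ∼`. -/
def tensorCoprodQuotient : CrossedModule P :=
  (coprod (tensor M N) C).quotient (relators M N C) (bd_relators M N C)

/-- The canonical map `M ⊗ N → ((M ⊗ N) ⊔ C) / ∼`. -/
def fromTensor : (tensor M N).carrier →ₗ[P] (tensorCoprodQuotient M N C).carrier :=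
  (coprod (tensor M N) C).quotientMk (relators M N C) (bd_relators M N C) ∘ₗ
    coprodInl (tensor M N) C

/-- The canonical map `C → ((M ⊗ N) ⊔ C) / ∼`. -/
def fromC : C.carrier →ₗ[P] (tensorCoprodQuotient M N C).carrier :=
  (coprod (tensor M N) C).quotientMk (relators M N C) (bd_relators M N C) ∘ₗ
    coprodInr (tensor M N) C

end CrossedModule

end

/-! The quotient `T = ((M ⊗ M̄) ⊔ C) / ∼` is itself a crossed square on the corner
`M → M ⋊ R ← M̄`, and it solves the universal problem that defines `L`.

Since `M → M ⋊ R` and `M̄ → M ⋊ R` are injective, maps into `M` or `M̄` are determined by their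
boundaries, so the axioms about `L → M` and `L → M̄` hold for `T` as soon as these maps exist. The
relations `∼` are exactly what is needed for `h (lam x, n) = n • x` and `h (m, lam' x) = m • x` on
the summand `C`; on `M ⊗ M̄` these identities hold by the Peiffer identity
(`CrossedModule.tensorCoprodSquare`).

The free crossed module `C` maps to `M` and to `M̄` because its generators have boundary in both
ideals, and to `L` because the diagonal `L → M ⋊ R` is a crossed module. Together with the `h`-map
of `L`, the latter map induces a morphism `T → L` (`CrossedModule.squareLift`). Freeness of `L`
gives a morphism `L → T`, and the two are mutually inverse: one composite is the identity by the
uniqueness for `L`, the other because it fixes the classes of all `m ⊗ n` and, by the uniqueness for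
`C`, those of all elements of `C`. -/

noncomputable section

open scoped TensorProduct

namespace PreCrossedModule

variable {P : Type u} [CommRing P]

theorem idealSpan_le_ker_of_map_mul (A : PreCrossedModule P) (s : Set A.carrier)
    (D : PreCrossedModule P) (f : A.carrier →ₗ[P] D.carrier)
    (hf : ∀ a b, f (a * b) = f a * f b) (hs : ∀ x ∈ s, f x = 0) :
    A.idealSpan s ≤ LinearMap.ker f := by
  refine A.idealSpan_le s _ (fun x hx => hs x hx) fun a x hx => ?_
  rw [LinearMap.mem_ker] at hx ⊢
  rw [hf, hx, mul_zero]

end PreCrossedModule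

namespace CrossedModule

variable {P : Type u} [CommRing P]

/-! ### Morphisms of crossed modules -/

/-- The composite of two morphisms of crossed modules. -/
def Hom.comp {A B D : CrossedModule P} (g : Hom B D) (f : Hom A B) : Hom A D where
  toFun := g.toFun ∘ₗ f.toFun
  map_mul a b := by simp only [LinearMap.comp_apply, f.map_mul, g.map_mul]
  bd_comp a := by simp only [LinearMap.comp_apply, g.bd_comp, f.bd_comp]

/-- The linear map `A ⋊ B → D`, `(a, b) ↦ f a + g b`. -/
def semidirectDesc {A B D : CrossedModule P} (f : Hom A D) (g : Hom B D) :
    (semidirect A B).carrier →ₗ[P] D.carrier :=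
  f.toFun.coprod g.toFun

theorem semidirectDesc_mul {A B D : CrossedModule P} (f : Hom A D) (g : Hom B D)
    (x y : (semidirect A B).carrier) :
    semidirectDesc f g (x * y) = semidirectDesc f g x * semidirectDesc f g y := by
  change f.toFun (x.1 * y.1) + g.toFun (A.bd y.1 • x.2 + A.bd x.1 • y.2 + x.2 * y.2) =
    (f.toFun x.1 + g.toFun x.2) * (f.toFun y.1 + g.toFun y.2)
  simp only [f.map_mul, map_add, map_smul, g.map_mul, mul_add, add_mul, ← f.bd_comp, D.peiffer]
  rw [mul_comm (g.toFun x.2) (f.toFun y.1)]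
  abel

theorem bd_semidirectDesc {A B D : CrossedModule P} (f : Hom A D) (g : Hom B D)
    (x : (semidirect A B).carrier) : D.bd (semidirectDesc f g x) = (semidirect A B).bd x := by
  change D.bd (f.toFun x.1 + g.toFun x.2) = A.bd x.1 + B.bd x.2
  rw [map_add, f.bd_comp, g.bd_comp]

/-- The morphism `A ⊔ B → D` given by morphisms `A → D` and `B → D`. -/
def coprodDesc {A B D : CrossedModule P} (f : Hom A D) (g : Hom B D) : Hom (coprod A B) D where
  toFun := ((semidirect A B).idealSpan (peifferElements A B)).liftQ (semidirectDesc f g)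
    ((semidirect A B).idealSpan_le_ker_of_map_mul _ D.toPreCrossedModule _
      (semidirectDesc_mul f g) (by
        rintro _ ⟨x, y, rfl⟩
        rw [map_sub, semidirectDesc_mul, map_smul, ← D.peiffer, bd_semidirectDesc, sub_self]))
  map_mul x y := by
    obtain ⟨a, rfl⟩ := PreCrossedModule.Quot.mk_surjective (semidirect A B) _ x
    obtain ⟨b, rfl⟩ := PreCrossedModule.Quot.mk_surjective (semidirect A B) _ y
    exact semidirectDesc_mul f g a b
  bd_comp x := by
    obtain ⟨a, rfl⟩ := PreCrossedModule.Quot.mk_surjective (semidirect A B) _ x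
    exact bd_semidirectDesc f g a

theorem coprodDesc_inl {A B D : CrossedModule P} (f : Hom A D) (g : Hom B D) (a : A.carrier) :
    (coprodDesc f g).toFun (coprodInl A B a) = f.toFun a := by
  change f.toFun a + g.toFun 0 = f.toFun a
  rw [map_zero, add_zero]

theorem coprodDesc_inr {A B D : CrossedModule P} (f : Hom A D) (g : Hom B D) (b : B.carrier) :
    (coprodDesc f g).toFun (coprodInr A B b) = g.toFun b := by
  change f.toFun 0 + g.toFun b = g.toFun b
  rw [map_zero, zero_add]

theorem coprodInr_mul (A B : CrossedModule P) (x y : B.carrier) :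
    coprodInr A B (x * y) = coprodInr A B x * coprodInr A B y := by
  let u : Semidirect A B := (0, x)
  let v : Semidirect A B := (0, y)
  let w : Semidirect A B := (0, x * y)
  have h : w = u * v := by
    refine Semidirect.ext (mul_zero (0 : A.carrier)).symm ?_
    change x * y = A.bd 0 • x + A.bd 0 • y + x * y
    simp only [map_zero, zero_smul, zero_add]
  exact congrArg (PreCrossedModule.Quot.mk (semidirect A B) (peifferElements A B)) h

theorem exists_eq_inl_add_inr (A B : CrossedModule P) (x : (coprod A B).carrier) :
    ∃ a b, x = coprodInl A B a + coprodInr A B b := by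
  obtain ⟨⟨a, b⟩, rfl⟩ := PreCrossedModule.Quot.mk_surjective (semidirect A B) _ x
  refine ⟨a, b, ?_⟩
  have h : ((a, b) : Semidirect A B) = ((a, 0) : Semidirect A B) + ((0, b) : Semidirect A B) := by
    ext
    · exact (add_zero a).symm
    · exact (zero_add b).symm
  exact (congrArg (PreCrossedModule.Quot.mk (semidirect A B) (peifferElements A B)) h).trans
    (map_add _ _ _)

/-- The morphism from the quotient of `A` by the ideal generated by `s` that is induced by a
morphism which vanishes on `s`. -/
def quotientDesc {A D : CrossedModule P} (s : Set A.carrier) (hs : ∀ x ∈ s, A.bd x = 0)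
    (f : Hom A D) (hf : ∀ x ∈ s, f.toFun x = 0) : Hom (A.quotient s hs) D where
  toFun := (A.idealSpan s).liftQ f.toFun
    (A.idealSpan_le_ker_of_map_mul s D.toPreCrossedModule f.toFun f.map_mul hf)
  map_mul x y := by
    obtain ⟨a, rfl⟩ := PreCrossedModule.Quot.mk_surjective A.toPreCrossedModule s x
    obtain ⟨b, rfl⟩ := PreCrossedModule.Quot.mk_surjective A.toPreCrossedModule s y
    exact f.map_mul a b
  bd_comp x := by
    obtain ⟨a, rfl⟩ := PreCrossedModule.Quot.mk_surjective A.toPreCrossedModule s x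
    exact f.bd_comp a

/-! ### The crossed module `((M ⊗ N) ⊔ C) / ∼` -/

theorem bd_tmul (M N : CrossedModule P) (m : M.carrier) (n : N.carrier) :
    (tensor M N).bd (tmul M N m n) = N.bd n * M.bd m := by
  change M.bd (N.bd n • m) = _
  rw [map_smul, smul_eq_mul]

theorem bd_tensorFst (M N : CrossedModule P) (t : (tensor M N).carrier) :
    M.bd (tensorFst M N t) = (tensor M N).bd t := rfl

theorem bd_tensorSnd (M N : CrossedModule P) (t : (tensor M N).carrier) :
    N.bd (tensorSnd M N t) = (tensor M N).bd t := by
  refine LinearMap.congr_fun (f := N.bd ∘ₗ tensorSnd M N) (g := M.bd ∘ₗ tensorFst M N)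
    (TensorProduct.ext' fun m n => ?_) t
  simp only [LinearMap.comp_apply, tensorFst_tmul, tensorSnd_tmul, map_smul, smul_eq_mul]
  exact mul_comm _ _

/-- A linear map that preserves the boundaries is a morphism if the boundary of the target is
injective. -/
def Hom.ofInjective {A D : CrossedModule P} (hD : Function.Injective D.bd)
    (f : A.carrier →ₗ[P] D.carrier) (hf : ∀ a, D.bd (f a) = A.bd a) : Hom A D where
  toFun := f
  map_mul a b := hD (by rw [hf, A.bd_mul, D.bd_mul, hf, hf])
  bd_comp := hf

variable {M N C : CrossedModule P}

/-- `tensorFst` as a morphism of crossed modules. -/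
def tensorFstHom (hM : Function.Injective M.bd) : Hom (tensor M N) M :=
  Hom.ofInjective hM (tensorFst M N) (bd_tensorFst M N)

/-- `tensorSnd` as a morphism of crossed modules. -/
def tensorSndHom (hN : Function.Injective N.bd) : Hom (tensor M N) N :=
  Hom.ofInjective hN (tensorSnd M N) (bd_tensorSnd M N)

variable (M N C) in
theorem exists_eq_fromTensor_add_fromC (x : (tensorCoprodQuotient M N C).carrier) :
    ∃ t c, x = fromTensor M N C t + fromC M N C c := by
  obtain ⟨a, rfl⟩ := PreCrossedModule.Quot.mk_surjective _ (relators M N C) x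
  obtain ⟨t, c, rfl⟩ := exists_eq_inl_add_inr _ _ a
  exact ⟨t, c, map_add _ _ _⟩

theorem bd_fromC (c : C.carrier) :
    (tensorCoprodQuotient M N C).bd (fromC M N C c) = C.bd c :=
  bd_coprodInr _ _ c

variable (M N C) in
/-- The canonical map `C → ((M ⊗ N) ⊔ C) / ∼`, as a morphism of crossed modules. -/
def fromCHom : Hom C (tensorCoprodQuotient M N C) where
  toFun := fromC M N C
  map_mul x y := congrArg
    ((coprod (tensor M N) C).quotientMk (relators M N C) (bd_relators M N C))
    (coprodInr_mul (tensor M N) C x y)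
  bd_comp := bd_fromC

theorem fromTensor_tmul_left (c : C.carrier) (m : M.carrier) (n : N.carrier)
    (h : M.bd m = C.bd c) :
    fromTensor M N C (tmul M N m n) = N.bd n • fromC M N C c := by
  rw [← map_smul]
  exact (Submodule.Quotient.eq _).2
    (PreCrossedModule.subset_idealSpan _ (relators M N C) (Or.inl ⟨c, m, n, h, rfl⟩))

theorem fromTensor_tmul_right (c : C.carrier) (m : M.carrier) (n : N.carrier)
    (h : N.bd n = C.bd c) :
    fromTensor M N C (tmul M N m n) = M.bd m • fromC M N C c := by
  rw [← map_smul]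
  exact (Submodule.Quotient.eq _).2
    (PreCrossedModule.subset_idealSpan _ (relators M N C) (Or.inr ⟨c, m, n, h, rfl⟩))

/-- The morphism `((M ⊗ N) ⊔ C) / ∼ → D` given by morphisms on `M ⊗ N` and on `C` that are
compatible with `∼`. -/
def tensorCoprodQuotientDesc {D : CrossedModule P} (f : Hom (tensor M N) D) (g : Hom C D)
    (hl : ∀ c m n, M.bd m = C.bd c → f.toFun (tmul M N m n) = N.bd n • g.toFun c)
    (hr : ∀ c m n, N.bd n = C.bd c → f.toFun (tmul M N m n) = M.bd m • g.toFun c) :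
    Hom (tensorCoprodQuotient M N C) D :=
  quotientDesc _ _ (coprodDesc f g) (by
    rintro z (⟨c, m, n, h, rfl⟩ | ⟨c, m, n, h, rfl⟩)
    · rw [map_sub, coprodDesc_inl, coprodDesc_inr, map_smul, hl c m n h, sub_self]
    · rw [map_sub, coprodDesc_inl, coprodDesc_inr, map_smul, hr c m n h, sub_self])

/-- The morphism `((M ⊗ N) ⊔ C) / ∼ → D` for `D` with injective boundary: the compatibility with
`∼` is automatic. -/
def descOfInjective {D : CrossedModule P} (hD : Function.Injective D.bd)
    (f : Hom (tensor M N) D) (g : Hom C D) : Hom (tensorCoprodQuotient M N C) D :=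
  tensorCoprodQuotientDesc f g
    (fun c m n h => hD (by
      rw [f.bd_comp, bd_tmul, map_smul, g.bd_comp, h, smul_eq_mul]))
    (fun c m n h => hD (by
      rw [f.bd_comp, bd_tmul, map_smul, g.bd_comp, h, smul_eq_mul, mul_comm]))

/-! ### The crossed square on `((M ⊗ N) ⊔ C) / ∼` -/

/-- The morphism `((M ⊗ N) ⊔ C) / ∼ → M` given by `m ⊗ n ↦ n • m` and by `α`. -/
def tensorCoprodFst (hM : Function.Injective M.bd) (α : Hom C M) :
    Hom (tensorCoprodQuotient M N C) M :=
  descOfInjective hM (tensorFstHom hM) α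

/-- The morphism `((M ⊗ N) ⊔ C) / ∼ → N` given by `m ⊗ n ↦ m • n` and by `β`. -/
def tensorCoprodSnd (hN : Function.Injective N.bd) (β : Hom C N) :
    Hom (tensorCoprodQuotient M N C) N :=
  descOfInjective hN (tensorSndHom hN) β

theorem tensorCoprodFst_fromTensor (hM : Function.Injective M.bd) (α : Hom C M)
    (t : (tensor M N).carrier) :
    (tensorCoprodFst hM α).toFun (fromTensor M N C t) = tensorFst M N t :=
  coprodDesc_inl (tensorFstHom hM) α t

theorem tensorCoprodSnd_fromTensor (hN : Function.Injective N.bd) (β : Hom C N)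
    (t : (tensor M N).carrier) :
    (tensorCoprodSnd hN β).toFun (fromTensor M N C t) = tensorSnd M N t :=
  coprodDesc_inl (tensorSndHom hN) β t

/-- The crossed square on `((M ⊗ N) ⊔ C) / ∼`, with `h (m, n) = i (m ⊗ n)`, for crossed modules `M`
and `N` with injective boundaries through which the boundary of `C` factors (by `α` and `β`). -/
def tensorCoprodSquare (hM : Function.Injective M.bd) (hN : Function.Injective N.bd)
    (α : Hom C M) (β : Hom C N) : CrossedSquare M N :=
  let lam := tensorCoprodFst hM α
  let lam' := tensorCoprodSnd hN β
  { L := (tensorCoprodQuotient M N C).carrier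
    lam := lam.toFun
    lam' := lam'.toFun
    lam_mul := lam.map_mul
    lam'_mul := lam'.map_mul
    comm := fun x => (lam.bd_comp x).trans (lam'.bd_comp x).symm
    peiffer := fun x y => by
      rw [lam.bd_comp]
      exact (tensorCoprodQuotient M N C).peiffer x y
    h := (TensorProduct.mk P M.carrier N.carrier).compr₂ (fromTensor M N C)
    lam_h := fun m n => tensorCoprodFst_fromTensor hM α (tmul M N m n)
    lam'_h := fun m n => tensorCoprodSnd_fromTensor hN β (tmul M N m n)
    h_lam := fun x n => by
      change fromTensor M N C (tmul M N (lam.toFun x) n) = N.bd n • x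
      obtain ⟨t, c, rfl⟩ := exists_eq_fromTensor_add_fromC M N C x
      have ht : tmul M N (tensorFst M N t) n = N.bd n • t := by
        refine LinearMap.congr_fun
          (f := (TensorProduct.mk P M.carrier N.carrier).flip n ∘ₗ tensorFst M N)
          (g := N.bd n • LinearMap.id) (TensorProduct.ext' fun m' n' => ?_) t
        change (N.bd n' • m') ⊗ₜ[P] n = N.bd n • (m' ⊗ₜ[P] n')
        rw [TensorProduct.smul_tmul, N.peiffer, mul_comm, ← N.peiffer, TensorProduct.tmul_smul]
      have hlam : lam.toFun (fromTensor M N C t) = tensorFst M N t :=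
        tensorCoprodFst_fromTensor hM α t
      have hc : M.bd (lam.toFun (fromC M N C c)) = C.bd c :=
        (lam.bd_comp _).trans (bd_fromC c)
      have hadd : ∀ a b : M.carrier, tmul M N (a + b) n = tmul M N a n + tmul M N b n :=
        fun a b => TensorProduct.add_tmul a b n
      rw [map_add, hadd, map_add, hlam, ht, fromTensor_tmul_left c _ n hc, map_smul, smul_add]
    h_lam' := fun m x => by
      change fromTensor M N C (tmul M N m (lam'.toFun x)) = M.bd m • x
      obtain ⟨t, c, rfl⟩ := exists_eq_fromTensor_add_fromC M N C x
      have ht : tmul M N m (tensorSnd M N t) = M.bd m • t := by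
        refine LinearMap.congr_fun
          (f := TensorProduct.mk P M.carrier N.carrier m ∘ₗ tensorSnd M N)
          (g := M.bd m • LinearMap.id) (TensorProduct.ext' fun m' n' => ?_) t
        change m ⊗ₜ[P] (M.bd m' • n') = M.bd m • (m' ⊗ₜ[P] n')
        rw [← TensorProduct.smul_tmul, M.peiffer, mul_comm, ← M.peiffer, TensorProduct.smul_tmul']
      have hlam' : lam'.toFun (fromTensor M N C t) = tensorSnd M N t :=
        tensorCoprodSnd_fromTensor hN β t
      have hc : N.bd (lam'.toFun (fromC M N C c)) = C.bd c :=
        (lam'.bd_comp _).trans (bd_fromC c)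
      have hadd : ∀ a b : N.carrier, tmul M N m (a + b) = tmul M N m a + tmul M N m b :=
        fun a b => TensorProduct.tmul_add m a b
      rw [map_add, hadd, map_add, hlam', ht, fromTensor_tmul_right c m _ hc, map_smul, smul_add] }

end CrossedModule

/-! ### Morphisms of crossed squares -/

namespace CrossedSquare

variable {P : Type u} [CommRing P] {M N : CrossedModule P}

/-- The diagonal `L → P` of a crossed square, as a crossed module. -/
def diagonal (X : CrossedSquare M N) : CrossedModule P where
  carrier := X.L
  bd := M.bd ∘ₗ X.lam
  bd_mul x y := by simp only [LinearMap.comp_apply, X.lam_mul, M.bd_mul]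
  peiffer := X.peiffer

/-- The identity morphism. -/
def Hom.id (X : CrossedSquare M N) : Hom X X where
  toFun := LinearMap.id
  map_mul _ _ := rfl
  lam_comp _ := rfl
  lam'_comp _ := rfl
  map_h _ _ := rfl

/-- The composite of two morphisms of crossed squares. -/
def Hom.comp {X Y Z : CrossedSquare M N} (g : Hom Y Z) (f : Hom X Y) : Hom X Z where
  toFun := g.toFun ∘ₗ f.toFun
  map_mul a b := by simp only [LinearMap.comp_apply, f.map_mul, g.map_mul]
  lam_comp a := by simp only [LinearMap.comp_apply, f.lam_comp, g.lam_comp]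
  lam'_comp a := by simp only [LinearMap.comp_apply, f.lam'_comp, g.lam'_comp]
  map_h m n := by simp only [LinearMap.comp_apply, f.map_h, g.map_h]

theorem h_mul_h (X : CrossedSquare M N) (m m' : M.carrier) (n n' : N.carrier) :
    X.h m n * X.h m' n' = X.h (m * m') (n * n') := by
  rw [← X.peiffer, X.lam_h, map_smul, smul_eq_mul, mul_smul, ← M.peiffer, ← N.peiffer, map_smul,
    LinearMap.map_smul₂]

/-- The morphism `M ⊗ N → L`, `m ⊗ n ↦ h (m, n)`. -/
def tensorHom (X : CrossedSquare M N) :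
    CrossedModule.Hom (CrossedModule.tensor M N) X.diagonal where
  toFun := TensorProduct.lift X.h
  map_mul x y := by
    change M.carrier ⊗[P] N.carrier at x y
    change TensorProduct.lift X.h (x * y) = TensorProduct.lift X.h x * TensorProduct.lift X.h y
    induction x using TensorProduct.induction_on with
    | zero => rw [zero_mul, map_zero, zero_mul]
    | add x x' hx hx' => rw [add_mul, map_add, map_add, add_mul, hx, hx']
    | tmul m n =>
      induction y using TensorProduct.induction_on with
      | zero => rw [mul_zero, map_zero, mul_zero]
      | add y y' hy hy' => rw [mul_add, map_add, map_add, mul_add, hy, hy']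
      | tmul m' n' =>
        rw [Algebra.TensorProduct.tmul_mul_tmul]
        exact (X.h_mul_h m m' n n').symm
  bd_comp t := by
    refine LinearMap.congr_fun (f := M.bd ∘ₗ X.lam ∘ₗ TensorProduct.lift X.h)
      (g := M.bd ∘ₗ CrossedModule.tensorFst M N) (TensorProduct.ext' fun m n => ?_) t
    exact congrArg M.bd (X.lam_h m n)

end CrossedSquare

namespace CrossedModule

variable {P : Type u} [CommRing P] {M N C : CrossedModule P}

section Lift

variable (hM : Function.Injective M.bd) (hN : Function.Injective N.bd) (X : CrossedSquare M N)
  (γ : Hom C X.diagonal)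

/-- For a crossed square `X` whose corner has injective boundaries, the morphism of crossed modules
from `((M ⊗ N) ⊔ C) / ∼` to the diagonal of `X` that is given by the `h`-map of `X` on `M ⊗ N` and
by `γ` on `C`. -/
def diagonalLift : Hom (tensorCoprodQuotient M N C) X.diagonal :=
  have hγ : ∀ c, M.bd (X.lam (γ.toFun c)) = C.bd c := γ.bd_comp
  tensorCoprodQuotientDesc X.tensorHom γ
    (fun c m n h => by
      obtain rfl : m = X.lam (γ.toFun c) := hM (h.trans (hγ c).symm)
      exact X.h_lam _ n)
    (fun c m n h => by
      obtain rfl : n = X.lam' (γ.toFun c) := hN (h.trans ((hγ c).symm.trans (X.comm _)))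
      exact X.h_lam' m _)

theorem diagonalLift_fromTensor (t : (tensor M N).carrier) :
    (diagonalLift hM hN X γ).toFun (fromTensor M N C t) = X.tensorHom.toFun t :=
  coprodDesc_inl X.tensorHom γ t

theorem diagonalLift_fromC (c : C.carrier) :
    (diagonalLift hM hN X γ).toFun (fromC M N C c) = γ.toFun c :=
  coprodDesc_inr X.tensorHom γ c

/-- The map `diagonalLift` as a morphism of crossed squares. -/
def squareLift (α : Hom C M) (β : Hom C N) :
    CrossedSquare.Hom (tensorCoprodSquare hM hN α β) X :=
  have hψ : ∀ x, M.bd (X.lam ((diagonalLift hM hN X γ).toFun x)) =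
    (tensorCoprodQuotient M N C).bd x := (diagonalLift hM hN X γ).bd_comp
  { toFun := (diagonalLift hM hN X γ).toFun
    map_mul := (diagonalLift hM hN X γ).map_mul
    lam_comp := fun x => hM ((hψ x).trans (Hom.bd_comp _ x).symm)
    lam'_comp := fun x => hN ((X.comm _).symm.trans ((hψ x).trans (Hom.bd_comp _ x).symm))
    map_h := fun m n => diagonalLift_fromTensor hM hN X γ (tmul M N m n) }

end Lift

/-- Two linear maps on `((M ⊗ N) ⊔ C) / ∼` agree if they agree on all `i (m ⊗ n)` and all `j c`. -/
theorem tensorCoprodQuotient_ext {D : Type*} [AddCommGroup D] [Module P D]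
    {f g : (tensorCoprodQuotient M N C).carrier →ₗ[P] D}
    (ht : ∀ m n, f (fromTensor M N C (tmul M N m n)) = g (fromTensor M N C (tmul M N m n)))
    (hc : ∀ c, f (fromC M N C c) = g (fromC M N C c)) : f = g := by
  ext x
  obtain ⟨t, c, rfl⟩ := exists_eq_fromTensor_add_fromC M N C x
  rw [map_add, map_add, hc]
  congr 1
  exact LinearMap.congr_fun (f := f ∘ₗ fromTensor M N C) (g := g ∘ₗ fromTensor M N C)
    (TensorProduct.ext' ht) t

end CrossedModule

namespace PreCrossedModule

variable {R : Type u} [CommRing R] (M : PreCrossedModule R)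

theorem incl_bd_injective : Function.Injective M.incl.bd :=
  Unitization.inr_injective

theorem bar_bd_injective : Function.Injective M.bar.bd :=
  Subtype.val_injective

end PreCrossedModule

/-! ### The free crossed square -/

open CrossedModule in
theorem proposition5p1 {R : Type u} [CommRing R] (M : PreCrossedModule R) {S₃ : Type u}
    (f₃ : S₃ → M.carrier) (hf₃ : ∀ y, M.bd (f₃ y) = 0)
    (X : CrossedSquare M.incl M.bar) (ν : S₃ → X.L) (hX : X.IsFree f₃ ν)
    (C : CrossedModule M.SemiR) (ι : S₃ → C.carrier)
    (hC : C.IsFree (fun y => (Unitization.inr (f₃ y) : M.SemiR)) ι) :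
    ∃ e : (CrossedModule.tensorCoprodQuotient M.incl M.bar C).carrier ≃ₗ[M.SemiR] X.L,
      (∀ x y, e (x * y) = e x * e y) ∧
      (∀ t, X.lam (e (CrossedModule.fromTensor M.incl M.bar C t)) =
        CrossedModule.tensorFst M.incl M.bar t) ∧
      (∀ t, X.lam' (e (CrossedModule.fromTensor M.incl M.bar C t)) =
        CrossedModule.tensorSnd M.incl M.bar t) ∧
      (∀ c, M.incl.bd (X.lam (e (CrossedModule.fromC M.incl M.bar C c))) = C.bd c) ∧
      (∀ c, M.bar.bd (X.lam' (e (CrossedModule.fromC M.incl M.bar C c))) = C.bd c) ∧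
      (∀ m n, X.h m n = e (CrossedModule.fromTensor M.incl M.bar C (CrossedModule.tmul M.incl M.bar m n))) ∧
      (∀ y, e (CrossedModule.fromC M.incl M.bar C (ι y)) = ν y) := by
  have hM := M.incl_bd_injective
  have hN := M.bar_bd_injective
  obtain ⟨α, -, -⟩ := hC.existsUnique M.incl f₃ fun _ => rfl
  -- `(f₃ y, 0)` lies in `M̄` because `∂ f₃ = 0`.
  have hbar : ∀ y, (Unitization.inr (f₃ y) : M.SemiR) ∈ M.barIdeal := fun y => by
    change M.bd (Unitization.inr (f₃ y) : M.SemiR).snd = -(Unitization.inr (f₃ y) : M.SemiR).fst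
    rw [Unitization.snd_inr, Unitization.fst_inr, hf₃, neg_zero]
  obtain ⟨β, -, -⟩ := hC.existsUnique M.bar (fun y => ⟨_, hbar y⟩) fun _ => rfl
  obtain ⟨γ, hγ, -⟩ := hC.existsUnique X.diagonal ν fun y => congrArg M.incl.bd (hX.lam_ν y)
  let Y := tensorCoprodSquare hM hN α β
  let ψ : CrossedSquare.Hom Y X := squareLift hM hN X γ α β
  have hψC : ∀ c, ψ.toFun (fromC M.incl M.bar C c) = γ.toFun c :=
    diagonalLift_fromC hM hN X γ
  have hbdY : ∀ x, M.incl.bd (Y.lam x) = (tensorCoprodQuotient M.incl M.bar C).bd x :=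
    fun x => CrossedModule.Hom.bd_comp _ x
  obtain ⟨φ, hφ, -⟩ := hX.existsUnique Y (fun y => fromC M.incl M.bar C (ι y)) fun y =>
    hM ((hbdY _).trans ((bd_fromC _).trans (hC.bd_ι y)))
  have hψφ : ψ.toFun ∘ₗ φ.toFun = LinearMap.id := by
    have := (hX.existsUnique X ν hX.lam_ν).unique (y₁ := ψ.comp φ)
      (y₂ := CrossedSquare.Hom.id X)
      (fun y => by
        change ψ.toFun (φ.toFun (ν y)) = ν y
        rw [hφ, hψC, hγ])
      fun _ => rfl
    exact congrArg CrossedSquare.Hom.toFun this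
  have hφψ : φ.toFun ∘ₗ ψ.toFun = LinearMap.id := by
    refine tensorCoprodQuotient_ext (fun m n => ?_) fun c => ?_
    · change φ.toFun (ψ.toFun (Y.h m n)) = Y.h m n
      rw [ψ.map_h, φ.map_h]
    · -- `φ ∘ γ` and `j` are morphisms `C → ((M ⊗ M̄) ⊔ C) / ∼` that agree on the generators.
      have hbdφ : ∀ x, (tensorCoprodQuotient M.incl M.bar C).bd (φ.toFun x) = X.diagonal.bd x :=
        fun x => (hbdY _).symm.trans (congrArg M.incl.bd (φ.lam_comp x))
      let φ' : CrossedModule.Hom X.diagonal (tensorCoprodQuotient M.incl M.bar C) :=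
        ⟨φ.toFun, φ.map_mul, hbdφ⟩
      have := (hC.existsUnique (tensorCoprodQuotient M.incl M.bar C)
        (fun y => fromC M.incl M.bar C (ι y)) fun y => (bd_fromC _).trans (hC.bd_ι y)).unique
        (y₁ := φ'.comp γ) (y₂ := fromCHom M.incl M.bar C)
        (fun y => by
          change φ.toFun (γ.toFun (ι y)) = _
          rw [hγ, hφ])
        fun _ => rfl
      change φ.toFun (ψ.toFun (fromC M.incl M.bar C c)) = fromC M.incl M.bar C c
      rw [hψC]
      exact congrArg (fun k => CrossedModule.Hom.toFun k c) this
  have hlamC : ∀ c, M.incl.bd (X.lam (ψ.toFun (fromC M.incl M.bar C c))) = C.bd c := fun c => by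
    rw [hψC]
    exact γ.bd_comp c
  refine ⟨LinearEquiv.ofLinearMap ψ.toFun φ.toFun hψφ hφψ, ψ.map_mul, fun t => ?_, fun t => ?_,
    hlamC, fun c => (X.comm _).symm.trans (hlamC c), fun m n => (ψ.map_h m n).symm,
    fun y => (hψC _).trans (hγ y)⟩
  · exact (ψ.lam_comp _).trans (tensorCoprodFst_fromTensor hM α t)
  · exact (ψ.lam'_comp _).trans (tensorCoprodSnd_fromTensor hN β t)

end
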